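/- Let $B_n$ be the lattice of all subsets of an $n$-element set, ordered by inclusion. A $t$-chain of a poset is a totally ordered subset with exactly $t$ elements; let $h(Q,t)$ be the number of $t$-chains of a finite poset $Q$, and $h_p(t)=h(B_p,t)$. For a poset $Q$, let $\mathrm R^{\sharp}_{k,t}(\mathcal B\mid Q)$ be the least $N\ge 1$ (and $\infty$ if there is none) such that for every coloring of the $t$-chains of $B_N$ with $k$ colors there is an induced copy of $Q$ in $B_N$ (the image of a map $f:Q\to B_N$ with $x\le y\iff f(x)\subseteq f(y)$) all of whose $t$-chains have one and the same color. For integers $p\ge 2$ and $1\le t\le p$ put $C_p=\binom{p}{\lfloor p/2\rfloor}$. For $k\ge 3$ let $$T_1(k)=p+\frac{h_p(t)+(h_p(t)-1)\log_2(k-1)-1}{4C_p},\qquad T_2=p+\frac{h_p(t)-1}{2C_p},$$ $$\mathrm R_1(k,p,t)=\min\{T_1(k),T_2\}$$ (for $t\ge2$, $\mathrm R_1(k,p,t)$ is the lower bound of Katona, Mao, Ozeki and Wang for $\mathrm R^{\sharp}_{k,t}(\mathcal B\mid B_p)$), and, for a constant $c>0$ and a sequence $\varepsilon_k\to0$, let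 $$\mathrm R_2(k,p,t)=p+\frac{(h_p(t)-1)(\log_2 k-\log_2 c)}{C_p\,(1+\varepsilon_k)}.$$ (i) Let $p\ge2$ and $1\le t\le p$. Then $\mathrm R_1(k,p,t)=T_2$ for every $k\ge3$. For every constant $c>0$ and every real sequence $\varepsilon_k\to 0$ (these may depend on $p$ and $t$), the following hold: $\mathrm R^{\sharp}_{k,t}(\mathcal B\mid B_p)\ge \mathrm R_2(k,p,t)$ for all sufficiently large $k$; $$\mathrm R_2(k,p,t)\sim\frac{h_p(t)-1}{C_p}\log_2 k\quad(k\to\infty);\qquad \lim_{k\to\infty}\frac{\mathrm R_2(k,p,t)}{\mathrm R_1(k,p,t)}=+\infty;$$ and there is $k_0$ such that $\mathrm R_2(k,p,t)>\mathrm R_1(k,p,t)$ for all $k>k_0$. (ii) For every $t\ge1$ and every nonempty finite poset $Q$ with $h(Q,t)\ge2$ there is a constant $c_Q=c_Q(t)>0$ such that, for all sufficiently large $k$, $$\mathrm R^{\sharp}_{k,t}(\mathcal B\mid Q)\ \ge\ \frac{h(Q,t)-1}{|Q|}\,\bigl(\log_2 k-\log_2 c_Q\bigr).$$ -/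

import Mathlib

open Filter Topology

noncomputable section

/-- The Boolean lattice `B_n`: all subsets of an `n`-element set, ordered by inclusion. -/
abbrev BooleanLattice (n : ℕ) : Type := Finset (Fin n)

/-- The `t`-chains of a poset `P`: its totally ordered subsets with exactly `t` elements. -/
def TChain (P : Type*) [PartialOrder P] (t : ℕ) : Type _ :=
  {s : Finset P // s.card = t ∧ IsChain (· ≤ ·) (s : Set P)}

/-- `h(P, t)`, the number of `t`-chains of a finite poset `P`. -/
def chainCount (P : Type*) [PartialOrder P] (t : ℕ) : ℕ := Nat.card (TChain P t)

/-- The colouring `χ` of the `t`-chains of `R` has a monochromatic induced copy of `P`: a strong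
embedding `f` of `P` into `R` (an order embedding) such that all `t`-chains of `R` that are
contained in the image of `f` have one and the same colour `i`. -/
def HasMonoInducedCopy (P : Type*) [PartialOrder P] {R : Type*} [PartialOrder R] {k t : ℕ}
    (χ : TChain R t → Fin k) : Prop :=
  ∃ (f : P ↪o R) (i : Fin k), ∀ T : TChain R t, (T.1 : Set R) ⊆ Set.range f → χ T = i

/-- The strong Boolean Ramsey number `R^♯_{k,t}(𝓑 | P)`: the least `N ≥ 1` such that every
`k`-colouring of the `t`-chains of `B_N` has a monochromatic induced copy of `P`
(and `⊤` if there were no such `N`). -/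
def strongBooleanRamsey (k t : ℕ) (P : Type*) [PartialOrder P] : ℕ∞ :=
  ⨅ (N : ℕ) (_ : 1 ≤ N ∧ ∀ χ : TChain (BooleanLattice N) t → Fin k, HasMonoInducedCopy P χ),
    (N : ℕ∞)

/-- The strong Boolean Ramsey number as an extended real, to compare it with real bounds. -/
def strongBooleanRamseyE (k t : ℕ) (P : Type*) [PartialOrder P] : EReal :=
  ((strongBooleanRamsey k t P : ENNReal) : EReal)

/-- `h_p(t)`, the number of `t`-chains of `B_p`, as a real number. -/
def hB (p t : ℕ) : ℝ := (chainCount (BooleanLattice p) t : ℝ)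

/-- The middle binomial coefficient `C_p = binom(p, ⌊p/2⌋)`, as a real number. -/
def middleBinom (p : ℕ) : ℝ := (Nat.choose p (p / 2) : ℝ)

/-- The first term `T_1(k)` in the Katona–Mao–Ozeki–Wang lower bound. -/
def boundT1 (k p t : ℕ) : ℝ :=
  p + (hB p t + (hB p t - 1) * Real.logb 2 ((k : ℝ) - 1) - 1) / (4 * middleBinom p)

/-- The second term `T_2` in the Katona–Mao–Ozeki–Wang lower bound. -/
def boundT2 (p t : ℕ) : ℝ := p + (hB p t - 1) / (2 * middleBinom p)

/-- The Katona–Mao–Ozeki–Wang lower bound `R_1(k,p,t)`. -/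
def oldBound (k p t : ℕ) : ℝ := min (boundT1 k p t) (boundT2 p t)

/-- The new lower bound `R_2(k,p,t)`, with constant `c` and with `ε` as the `o(1)` term. -/
def newBound (c : ℝ) (ε : ℕ → ℝ) (k p t : ℕ) : ℝ :=
  p + (hB p t - 1) * (Real.logb 2 k - Real.logb 2 c) / (middleBinom p * (1 + ε k))

end

/-!
The two lower bounds on `R^♯` have different sources.

For a general poset `Q` the bound is a first-moment count. If every `k`-colouring of the `t`-chains
of `B_N` has a monochromatic copy of `Q`, then a colouring is determined by such a copy, its colour,
and the colouring off the `h = h(Q, t)` chains of the copy. There are at most `2 ^ (N |Q|)` copies,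
so `k ^ h ≤ 2 ^ (N |Q|) * k`, and taking logarithms gives `N ≥ (h - 1) / |Q| * log₂ k`
(`pow_le_of_forall_hasMonoInducedCopy`, `logb_le_of_forall_hasMonoInducedCopy`); thus `c_Q = 1`
works.

For `B_p` with `t ≤ p` much more is true. Colour a `t`-chain of `B_N` by the sum of the sizes of its
members, which uses at most `t N + 1` colours. A copy of `B_p` contains a chain of `t + 1` elements,
and omitting its top or its bottom yields two `t`-chains with different sums. Hence `k ≤ t N`
(`le_mul_of_forall_hasMonoInducedCopy`): the Ramsey number grows at least linearly in `k`, which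
beats the logarithmic bound `R_2` for every choice of `c` and of `ε → 0`.

The remaining claims compare `R_1`, which is the constant `T_2` because `log₂ (k - 1) ≥ 1` for
`k ≥ 3`, with `R_2`, which is asymptotic to a positive multiple of `log₂ k`; the multiple is
positive because the two `t`-chains above show `h_p(t) ≥ 2`.
-/

open Asymptotics

instance TChain.instFinite (P : Type*) [PartialOrder P] [Finite P] (t : ℕ) :
    Finite (TChain P t) :=
  Subtype.finite

/-- The image of a `t`-chain under an order embedding. -/
def TChain.map {P R : Type*} [PartialOrder P] [PartialOrder R] {t : ℕ} (f : P ↪o R)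
    (T : TChain P t) : TChain R t :=
  ⟨T.1.map f.toEmbedding, by rw [Finset.card_map, T.2.1], by
    rw [Finset.coe_map]
    rintro _ ⟨a, ha, rfl⟩ _ ⟨b, hb, rfl⟩ -
    exact (T.2.2.total ha hb).imp (fun h => f.monotone h) fun h => f.monotone h⟩

theorem TChain.map_injective {P R : Type*} [PartialOrder P] [PartialOrder R] {t : ℕ}
    (f : P ↪o R) : Function.Injective (TChain.map (t := t) f) := fun _ _ h =>
  Subtype.ext (Finset.map_injective _ (congrArg Subtype.val h))

theorem TChain.coe_map_subset_range {P R : Type*} [PartialOrder P] [PartialOrder R] {t : ℕ}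
    (f : P ↪o R) (T : TChain P t) : ((T.map f).1 : Set R) ⊆ Set.range f := by
  simp only [TChain.map, Finset.coe_map]
  exact Set.image_subset_range _ _

/-- A real number is a lower bound for the Ramsey number as soon as it is a lower bound for every
admissible dimension `N`. -/
theorem le_strongBooleanRamseyE {P : Type*} [PartialOrder P] {k t : ℕ} {x : ℝ}
    (hx : ∀ N : ℕ, (∀ χ : TChain (BooleanLattice N) t → Fin k, HasMonoInducedCopy P χ) →
      x ≤ N) : (x : EReal) ≤ strongBooleanRamseyE k t P := by
  have h : ((⌈x⌉₊ : ℕ) : ℕ∞) ≤ strongBooleanRamsey k t P :=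
    le_iInf₂ fun N hN => by exact_mod_cast Nat.ceil_le.2 (hx N hN.2)
  have h1 : (((⌈x⌉₊ : ℕ) : ℕ∞) : ENNReal) ≤ (strongBooleanRamsey k t P : ENNReal) := by
    exact_mod_cast h
  have h2 : ((((⌈x⌉₊ : ℕ) : ℕ∞) : ENNReal) : EReal) ≤ strongBooleanRamseyE k t P :=
    EReal.coe_ennreal_le_coe_ennreal_iff.2 h1
  refine le_trans ?_ h2
  have h3 : ((((⌈x⌉₊ : ℕ) : ℕ∞) : ENNReal) : EReal) = (((⌈x⌉₊ : ℕ) : ℝ) : EReal) := by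
    rw [ENat.toENNReal_coe, ← ENNReal.ofReal_natCast, EReal.coe_ennreal_ofReal,
      max_eq_left (Nat.cast_nonneg _)]
  rw [h3]
  exact EReal.coe_le_coe_iff.2 (Nat.le_ceil x)

/-! ### The counting bound for an arbitrary finite poset -/

theorem pow_le_of_forall_hasMonoInducedCopy {Q : Type*} [PartialOrder Q] [Finite Q]
    {k t N : ℕ} (hk : 0 < k)
    (h : ∀ χ : TChain (BooleanLattice N) t → Fin k, HasMonoInducedCopy Q χ) :
    k ^ chainCount Q t ≤ 2 ^ (N * Nat.card Q) * k := by
  choose f i hfi using h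
  -- Overwriting `χ` on the chains of its monochromatic copy by arbitrary colours `g` loses no
  -- information once the copy and its colour are recorded.
  let Φ : (TChain (BooleanLattice N) t → Fin k) × (TChain Q t → Fin k) →
      ((Q → BooleanLattice N) × Fin k) × (TChain (BooleanLattice N) t → Fin k) :=
    fun x => ((f x.1, i x.1), Function.extend (TChain.map (f x.1)) x.2 x.1)
  have hΦ : Function.Injective Φ := by
    rintro ⟨χ, g⟩ ⟨χ', g'⟩ hx
    simp only [Φ, Prod.mk.injEq] at hx
    obtain ⟨⟨hf, hi⟩, hext⟩ := hx
    have hf : f χ = f χ' := DFunLike.coe_injective hf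
    have hg : g = g' := by
      funext T
      have := congrFun hext (TChain.map (f χ) T)
      rw [← hf] at this
      rwa [(TChain.map_injective _).extend_apply, (TChain.map_injective _).extend_apply] at this
    have hχ : χ = χ' := by
      funext T
      by_cases hT : ∃ S, TChain.map (f χ) S = T
      · obtain ⟨S, rfl⟩ := hT
        rw [hfi χ _ (TChain.coe_map_subset_range _ _), hi,
          hfi χ' _ (hf ▸ TChain.coe_map_subset_range _ _)]
      · have := congrFun hext T
        rw [← hf] at this
        rwa [Function.extend_apply' _ _ _ hT, Function.extend_apply' _ _ _ hT] at this
    rw [hχ, hg]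
  have hcard := Nat.card_le_card_of_injective Φ hΦ
  have : Fintype Q := Fintype.ofFinite Q
  simp only [Nat.card_prod, Nat.card_fun, Nat.card_eq_fintype_card, Fintype.card_fin,
    Fintype.card_finset, ← pow_mul] at hcard
  rw [mul_comm] at hcard
  rw [chainCount, Nat.card_eq_fintype_card (α := Q)]
  exact Nat.le_of_mul_le_mul_right hcard (pow_pos hk _)

theorem logb_le_of_forall_hasMonoInducedCopy {Q : Type*} [PartialOrder Q] [Finite Q]
    {k t N : ℕ} (hk : 0 < k)
    (h : ∀ χ : TChain (BooleanLattice N) t → Fin k, HasMonoInducedCopy Q χ) :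
    ((chainCount Q t : ℝ) - 1) * Real.logb 2 k ≤ N * Nat.card Q := by
  have h1 : (k : ℝ) ^ chainCount Q t ≤ 2 ^ (N * Nat.card Q) * k := by
    exact_mod_cast pow_le_of_forall_hasMonoInducedCopy hk h
  have hk' : (0 : ℝ) < k := by exact_mod_cast hk
  have h2 := Real.logb_le_logb_of_le (b := 2) (by norm_num) (by positivity) h1
  rw [Real.logb_mul (by positivity) hk'.ne', Real.logb_pow, Real.logb_pow,
    Real.logb_self_eq_one (by norm_num)] at h2
  push_cast at h2
  linarith

/-! ### The linear bound for Boolean lattices -/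

/-- The initial segment `{j | j < i}` of the ground set of `B_p`. -/
def initialSegment (p i : ℕ) : BooleanLattice p :=
  Finset.univ.filter fun j => (j : ℕ) < i

theorem initialSegment_mono (p : ℕ) : Monotone (initialSegment p) := fun a b hab j hj => by
  simp only [initialSegment, Finset.mem_filter, Finset.mem_univ, true_and] at hj ⊢
  exact hj.trans_le hab

theorem initialSegment_lt {p i j : ℕ} (hij : i < j) (hj : j ≤ p) :
    initialSegment p i < initialSegment p j := by
  refine lt_of_le_not_ge (initialSegment_mono p hij.le) fun hle => ?_
  have : (⟨i, hij.trans_le hj⟩ : Fin p) ∈ initialSegment p i :=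
    hle (by simpa [initialSegment] using hij)
  simp [initialSegment] at this

/-- The `t`-chain of `B_p` formed by the initial segments of sizes `m, …, m + t - 1`. -/
def initialSegmentChain (p t m : ℕ) (h : t + m ≤ p + 1) : TChain (BooleanLattice p) t :=
  ⟨(Finset.range t).image fun i => initialSegment p (i + m), by
    rw [Finset.card_image_of_injOn, Finset.card_range]
    intro a ha b hb hab
    simp only [Finset.coe_range, Set.mem_Iio] at ha hb
    rcases lt_trichotomy a b with hlt | heq | hlt
    · exact absurd hab (initialSegment_lt (by omega) (by omega)).ne
    · exact heq
    · exact absurd hab (initialSegment_lt (by omega) (by omega)).ne', by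
    rw [Finset.coe_image]
    rintro _ ⟨a, -, rfl⟩ _ ⟨b, -, rfl⟩ -
    rcases le_total a b with hab | hab
    · exact Or.inl (initialSegment_mono p (by omega))
    · exact Or.inr (initialSegment_mono p (by omega))⟩

/-- The sum of the sizes of the members of a chain of `B_N`. -/
def TChain.sizeSum {N t : ℕ} (T : TChain (BooleanLattice N) t) : ℕ := ∑ A ∈ T.1, A.card

theorem TChain.sizeSum_le {N t : ℕ} (T : TChain (BooleanLattice N) t) : T.sizeSum ≤ t * N := by
  have h := Finset.sum_le_card_nsmul T.1 (fun A => A.card) N fun A _ => card_finset_fin_le A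
  rwa [T.2.1] at h

theorem sizeSum_map_initialSegmentChain {p t m N : ℕ} (h : t + m ≤ p + 1)
    (f : BooleanLattice p ↪o BooleanLattice N) :
    ((initialSegmentChain p t m h).map f).sizeSum =
      ∑ i ∈ Finset.range t, (f (initialSegment p (i + m))).card := by
  have hinj : Set.InjOn (fun i => initialSegment p (i + m)) (Finset.range t : Set ℕ) := by
    exact Finset.card_image_iff.1
      ((initialSegmentChain p t m h).2.1.trans (Finset.card_range t).symm)
  simp only [TChain.sizeSum, TChain.map, initialSegmentChain, Finset.sum_map,
    Finset.sum_image hinj]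
  rfl

theorem sizeSum_map_lt {p t N : ℕ} (ht : 1 ≤ t) (htp : t ≤ p)
    (f : BooleanLattice p ↪o BooleanLattice N) :
    ((initialSegmentChain p t 0 (by omega)).map f).sizeSum <
      ((initialSegmentChain p t 1 (by omega)).map f).sizeSum := by
  rw [sizeSum_map_initialSegmentChain, sizeSum_map_initialSegmentChain]
  refine Finset.sum_lt_sum_of_nonempty ⟨0, Finset.mem_range.2 ht⟩ fun i hi => ?_
  rw [Finset.mem_range] at hi
  exact Finset.card_lt_card (f.strictMono (initialSegment_lt (by omega) (by omega)))

theorem two_le_chainCount_booleanLattice {p t : ℕ} (ht : 1 ≤ t) (htp : t ≤ p) :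
    2 ≤ chainCount (BooleanLattice p) t := by
  have : Nontrivial (TChain (BooleanLattice p) t) := by
    refine ⟨initialSegmentChain p t 0 (by omega), initialSegmentChain p t 1 (by omega),
      fun h => ?_⟩
    have := sizeSum_map_lt ht htp (RelEmbedding.refl _)
    rw [h] at this
    exact this.ne rfl
  exact Finite.one_lt_card

/-- The colouring by `TChain.sizeSum` needs `t * N + 1` colours and has no monochromatic copy of
`B_p`, so fewer dimensions than `k / t` never force one. -/
theorem le_mul_of_forall_hasMonoInducedCopy {k p t N : ℕ} (ht : 1 ≤ t) (htp : t ≤ p)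
    (h : ∀ χ : TChain (BooleanLattice N) t → Fin k,
      HasMonoInducedCopy (BooleanLattice p) χ) : k ≤ t * N := by
  by_contra! hk
  obtain ⟨f, i, hf⟩ := h fun T => ⟨T.sizeSum, T.sizeSum_le.trans_lt hk⟩
  have h0 := hf _ (TChain.coe_map_subset_range f (initialSegmentChain p t 0 (by omega)))
  have h1 := hf _ (TChain.coe_map_subset_range f (initialSegmentChain p t 1 (by omega)))
  exact (sizeSum_map_lt ht htp f).ne (congrArg Fin.val (h0.trans h1.symm))

/-! ### Comparison of the explicit bounds -/

theorem middleBinom_pos (p : ℕ) : 0 < middleBinom p := by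
  exact Nat.cast_pos.2 (Nat.choose_pos (Nat.div_le_self p 2))

theorem oldBound_eq_boundT2 {k p t : ℕ} (hh : 1 ≤ hB p t) (hk : 3 ≤ k) :
    oldBound k p t = boundT2 p t := by
  refine min_eq_right ?_
  have hk' : (3 : ℝ) ≤ k := by exact_mod_cast hk
  have hlog : 1 ≤ Real.logb 2 ((k : ℝ) - 1) := by
    rw [Real.le_logb_iff_rpow_le (by norm_num) (by linarith)]
    norm_num
    linarith
  have hC := middleBinom_pos p
  unfold boundT1 boundT2
  rw [add_le_add_iff_left, div_le_div_iff₀ (by positivity) (by positivity)]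
  nlinarith [mul_nonneg (mul_nonneg (sub_nonneg.2 hh) (sub_nonneg.2 hlog)) hC.le]

theorem tendsto_logb_natCast_atTop :
    Tendsto (fun k : ℕ => Real.logb 2 (k : ℝ)) atTop atTop :=
  (Real.tendsto_logb_atTop (by norm_num)).comp tendsto_natCast_atTop_atTop

theorem newBound_isEquivalent {p t : ℕ} (hh : 1 < hB p t) (c : ℝ) {ε : ℕ → ℝ}
    (hε : Tendsto ε atTop (𝓝 0)) :
    IsEquivalent atTop (fun k : ℕ => newBound c ε k p t)
      (fun k : ℕ => (hB p t - 1) / middleBinom p * Real.logb 2 k) := by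
  have hC := middleBinom_pos p
  have hL := tendsto_logb_natCast_atTop
  have ha : 0 < (hB p t - 1) / middleBinom p := div_pos (sub_pos.2 hh) hC
  set a := (hB p t - 1) / middleBinom p with ha_def
  have hinv : Tendsto (fun k : ℕ => (Real.logb 2 (k : ℝ))⁻¹) atTop (𝓝 0) :=
    tendsto_inv_atTop_zero.comp hL
  have h1 : Tendsto (fun k : ℕ => (p : ℝ) / a * (Real.logb 2 (k : ℝ))⁻¹ +
      (1 - Real.logb 2 c * (Real.logb 2 (k : ℝ))⁻¹) / (1 + ε k)) atTop (𝓝 1) := by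
    have := (hinv.const_mul ((p : ℝ) / a)).add
      (((hinv.const_mul (Real.logb 2 c)).const_sub 1).div (hε.const_add 1) (by norm_num))
    simpa using this
  refine isEquivalent_of_tendsto_one (h1.congr' ?_)
  filter_upwards [hL.eventually_gt_atTop 0, hε.eventually_const_lt (by norm_num : (-1 : ℝ) < 0)]
    with k hk hεk
  have h1ε : 1 + ε k ≠ 0 := by linarith
  have hh' : hB p t - 1 ≠ 0 := (sub_pos.2 hh).ne'
  simp only [Pi.div_apply, newBound, ha_def]
  field_simp

theorem newBound_tendsto_atTop {p t : ℕ} (hh : 1 < hB p t) (c : ℝ) {ε : ℕ → ℝ}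
    (hε : Tendsto ε atTop (𝓝 0)) : Tendsto (fun k : ℕ => newBound c ε k p t) atTop atTop :=
  (newBound_isEquivalent hh c hε).symm.tendsto_atTop
    (tendsto_logb_natCast_atTop.const_mul_atTop (div_pos (sub_pos.2 hh) (middleBinom_pos p)))

theorem newBound_isLittleO {p t : ℕ} (hh : 1 < hB p t) (c : ℝ) {ε : ℕ → ℝ}
    (hε : Tendsto ε atTop (𝓝 0)) :
    (fun k : ℕ => newBound c ε k p t) =o[atTop] (fun k : ℕ => (k : ℝ)) := by
  refine (newBound_isEquivalent hh c hε).isBigO.trans_isLittleO (IsLittleO.const_mul_left ?_ _)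
  have h : (fun k : ℕ => Real.log (k : ℝ)) =o[atTop] (fun k : ℕ => (k : ℝ)) :=
    Real.isLittleO_log_id_atTop.comp_tendsto tendsto_natCast_atTop_atTop
  simpa only [Real.logb, div_eq_inv_mul] using h.const_mul_left (Real.log 2)⁻¹

theorem eventually_newBound_le_strongBooleanRamseyE {p t : ℕ} (ht : 1 ≤ t) (htp : t ≤ p)
    (hh : 1 < hB p t) (c : ℝ) {ε : ℕ → ℝ} (hε : Tendsto ε atTop (𝓝 0)) :
    ∀ᶠ k : ℕ in atTop,
      (newBound c ε k p t : EReal) ≤ strongBooleanRamseyE k t (BooleanLattice p) := by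
  have ht' : (0 : ℝ) < t := by exact_mod_cast ht
  filter_upwards [(newBound_isLittleO hh c hε).bound (inv_pos.2 ht')] with k hk
  refine le_strongBooleanRamseyE fun N hN => ?_
  have hkN : (k : ℝ) ≤ t * N := by
    exact_mod_cast le_mul_of_forall_hasMonoInducedCopy ht htp hN
  rw [Real.norm_natCast] at hk
  calc newBound c ε k p t ≤ (t : ℝ)⁻¹ * k := (Real.le_norm_self _).trans hk
    _ ≤ N := by rwa [inv_mul_le_iff₀ ht']

theorem proposition5p4 :
    -- (i) comparison of the two lower bounds for `B_p`
    (∀ p t : ℕ, 2 ≤ p → 1 ≤ t → t ≤ p →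
      (∀ k : ℕ, 3 ≤ k → oldBound k p t = boundT2 p t) ∧
      ∀ (c : ℝ) (ε : ℕ → ℝ), 0 < c → Tendsto ε atTop (𝓝 0) →
        (∀ᶠ k : ℕ in atTop,
          (newBound c ε k p t : EReal) ≤ strongBooleanRamseyE k t (BooleanLattice p)) ∧
        Asymptotics.IsEquivalent atTop (fun k : ℕ => newBound c ε k p t)
          (fun k : ℕ => (hB p t - 1) / middleBinom p * Real.logb 2 k) ∧
        Tendsto (fun k : ℕ => newBound c ε k p t / oldBound k p t) atTop atTop ∧
        ∃ k₀ : ℕ, ∀ k : ℕ, k₀ < k → oldBound k p t < newBound c ε k p t) ∧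
    -- (ii) the logarithmic lower bound for every finite poset
    (∀ (t : ℕ) (Q : Type*) [PartialOrder Q] [Finite Q] [Nonempty Q],
      1 ≤ t → 2 ≤ chainCount Q t →
      ∃ c : ℝ, 0 < c ∧ ∀ᶠ k : ℕ in atTop,
        ((((chainCount Q t : ℝ) - 1) / (Nat.card Q : ℝ) *
          (Real.logb 2 k - Real.logb 2 c) : ℝ) : EReal) ≤ strongBooleanRamseyE k t Q) := by
  refine ⟨fun p t _ ht htp => ?_, fun t Q _ _ _ _ _ => ?_⟩
  · have hh : 1 < hB p t := Nat.one_lt_cast.2 (two_le_chainCount_booleanLattice ht htp)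
    refine ⟨fun k hk => oldBound_eq_boundT2 hh.le hk, fun c ε _ hε =>
      ⟨eventually_newBound_le_strongBooleanRamseyE ht htp hh c hε,
        newBound_isEquivalent hh c hε, ?_, ?_⟩⟩
    · have hT2 : 0 < boundT2 p t :=
        add_pos_of_nonneg_of_pos p.cast_nonneg
          (div_pos (sub_pos.2 hh) (mul_pos two_pos (middleBinom_pos p)))
      refine ((newBound_tendsto_atTop hh c hε).atTop_div_const hT2).congr' ?_
      filter_upwards [eventually_ge_atTop 3] with k hk
      rw [oldBound_eq_boundT2 hh.le hk]
    · obtain ⟨k₀, hk₀⟩ := eventually_atTop.1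
        (((newBound_tendsto_atTop hh c hε).eventually_gt_atTop (boundT2 p t)).and
          (eventually_ge_atTop 3))
      refine ⟨k₀, fun k hk => ?_⟩
      obtain ⟨h1, h2⟩ := hk₀ k hk.le
      rwa [oldBound_eq_boundT2 hh.le h2]
  · refine ⟨1, one_pos, ?_⟩
    filter_upwards [eventually_gt_atTop 0] with k hk
    refine le_strongBooleanRamseyE fun N hN => ?_
    have hQ : (0 : ℝ) < Nat.card Q := by exact_mod_cast Nat.card_pos
    rw [Real.logb_one, sub_zero, div_mul_eq_mul_div, div_le_iff₀ hQ]
    exact logb_le_of_forall_hasMonoInducedCopy hk hN
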